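/- **Conventions.** Pauli operators are taken modulo phases. A *subsystem code* is given by its gauge group $\mathcal G$, a group of Pauli operators on finitely many qubits; $N(\mathcal G)$ is the group of Pauli operators that commute with all of $\mathcal G$. It is an $[[n,k,d]]$ code if it has $n$ qubits, $N(\mathcal G)/(N(\mathcal G)\cap\mathcal G)$ has order $2^{2k}$, and $d$ is the minimum weight of an element of $N(\mathcal G)\cdot\mathcal G\setminus\mathcal G$ ($d=\infty$ if there is none). A *stabilizer code* is the case in which $\mathcal G$ is generated by pairwise commuting checks. Let $\omega$ be the maximum check weight and $\delta$ the maximum number of checks acting on one qubit. **Trivalent resolution.** Let $\mathcal C$ be a stabilizer code with given checks. Choose an order of the qubits in each check, an order of the checks acting as $P$ on $q$ for each qubit $q$ and each $P\in\{X,Y,Z\}$, and a set of qubits to be reduced that contains all qubits lying in more than three checks. * *Copies.* If $q$ is to be reduced and $\delta_P\ge 2$ checks act on it as $P$, add copy qubits $r_1,\dots,r_{\delta_P-1}$ with the gauge checks $P_qZ_{r_1}$, $Z_{r_1}Z_{r_2}$, $\dots$, $Z_{r_{\delta_P-2}}Z_{r_{\delta_P-1}}$, and in the $i$-th of these $\delta_P$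 checks replace $P_q$ by $Z_{r_{\min(i,\delta_P-1)}}$. * *Ancillas.* Let $Q_1Q_2\cdots Q_w$ be a resulting check, in the chosen order. If $w\ge 4$, add ancillary qubits $a_1,\dots,a_{w-3}$ and replace the check by the gauge checks $Q_1Q_2Z_{a_1}$, $Z_{a_1}Q_3Z_{a_2}$, $\dots$, $Z_{a_{w-4}}Q_{w-2}Z_{a_{w-3}}$, $Z_{a_{w-3}}Q_{w-1}Q_w$; if $w\le 3$, keep it. The *trivalent resolution* is the bipartite Tanner graph of all the qubits and of the checks just listed, with an edge between a check and each qubit on which it acts. **Embedding.** A *$c$-to-one embedding* of the trivalent resolution into a graph $G$ sends vertices to vertices of $G$ and each edge to a path in $G$ of positive length between the images of its endpoints, such that at most $c$ vertices are sent to any one vertex of $G$ and the paths of at most $c$ edges pass through any one edge of $G$. The length $\ell_e$ of an edge $e$ is the length of its path, and $\ell_{\max}=\max_e\ell_e$. **Edge-extended wire code.** For each edge $e$ from a qubit $q$ to a check $x$ that acts on $q$ as $P$, if $\ell_e\ge 2$ add qubits $t_1,\dots,t_{\ell_e-1}$ with the gauge checks $P_qZ_{t_1}$, $Z_{t_1}Z_{t_2}$,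 $\dots$, $Z_{t_{\ell_e-2}}Z_{t_{\ell_e-1}}$, and replace the factor $P_q$ of $x$ by $Z_{t_{\ell_e-1}}$; if $\ell_e=1$, change nothing. The gauge group is generated by all the resulting checks together with a single-qubit check $X$ on every qubit that is not a qubit of $\mathcal C$. **Locations.** The qubits of the trivalent resolution are located at their images in $G$. If the path of $e$ is $p_0,p_1,\dots,p_{\ell_e}$ with $p_0$ the image of the qubit end, then $t_i$ is located on the edge $\{p_i,p_{i+1}\}$ of $G$. **Theorem (Wire code graph embedding).** There are universal constants $C_1,C_2$ with the following property. Let $\mathcal C$ be an $[[n,k,d]]$ stabilizer code, at least one of whose checks is not the identity, and let a $c$-to-one embedding of a trivalent resolution of its Tanner graph into a graph $G$ be given. Then the edge-extended wire code is an $[[n',k,d']]$ subsystem code with $$n'\le C_1\,\ell_{\max}\,\delta\, n,\qquad d\le C_2\,\omega\, d',$$ that is, an $[[O(\ell_{\max}\delta n),k,\Omega(d/\omega)]]$ subsystem code. Its gauge checks are local on $G$: for every gauge check there is a vertex $v$ of $G$ such that each qubit on which the check acts is located at $v$, at a neighbour of $v$, or on an edge incident to $v$. Its qubit density on $G$ is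 bounded by $c$: at most $c$ qubits are located at any one vertex and at most $c$ on any one edge of $G$. -/

import Mathlib

/-! ### Pauli operators modulo phases -/

/-- Single-qubit Pauli operators modulo phases, as pairs `(x, z)` standing for `X ^ x * Z ^ z`:
`X = (1, 0)`, `Z = (0, 1)`, `Y = (1, 1)`, identity `0`; the product of operators is `+`. -/
abbrev Pauli : Type := ZMod 2 × ZMod 2

/-- The Pauli operator `X`. -/
def Pauli.X : Pauli := (1, 0)

/-- The Pauli operator `Z`. -/
def Pauli.Z : Pauli := (0, 1)

/-- The non-identity single-qubit Pauli operators `X`, `Y`, `Z`. -/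
abbrev PauliLetter : Type := {P : Pauli // P ≠ 0}

instance : DecidableEq PauliLetter := inferInstance

/-- The Pauli group, modulo phases, of a system whose qubits are labelled by `Q`. -/
abbrev PauliString (Q : Type*) : Type _ := Q → Pauli

/-- The operator that acts as `P` on the qubit `q` and trivially elsewhere. -/
def PauliString.on {Q : Type*} [DecidableEq Q] (q : Q) (P : Pauli) : PauliString Q :=
  Pi.single q P

/-- The number of qubits on which a Pauli operator acts non-trivially. -/
def PauliString.weight {Q : Type*} [Fintype Q] (p : PauliString Q) : ℕ :=
  (Finset.univ.filter fun q => p q ≠ 0).card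

/-- The commutator pairing: `0` if the two operators commute, `1` if they anticommute. -/
def PauliString.commutator {Q : Type*} [Fintype Q] (p r : PauliString Q) : ZMod 2 :=
  ∑ q, ((p q).1 * (r q).2 + (p q).2 * (r q).1)

/-! ### Subsystem codes and their parameters -/

/-- The Pauli operators that commute with every element of the gauge group `G`
(the normalizer of `G` in the Pauli group; its elements outside `G` are the bare logicals). -/
def commutant {Q : Type*} [Fintype Q] (G : Submodule (ZMod 2) (PauliString Q)) :
    Submodule (ZMod 2) (PauliString Q) where
  carrier := {p | ∀ g ∈ G, PauliString.commutator p g = 0}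
  zero_mem' := by
    intro g _
    simp [PauliString.commutator]
  add_mem' := by
    intro a b ha hb g hg
    have h : PauliString.commutator (a + b) g
        = PauliString.commutator a g + PauliString.commutator b g := by
      simp only [PauliString.commutator, ← Finset.sum_add_distrib]
      refine Finset.sum_congr rfl fun q _ => ?_
      simp only [Pi.add_apply, Prod.fst_add, Prod.snd_add]
      ring
    rw [h, ha g hg, hb g hg, add_zero]
  smul_mem' := by
    intro t a ha g hg
    have h : PauliString.commutator (t • a) g = t * PauliString.commutator a g := by
      simp only [PauliString.commutator, Finset.mul_sum]
      refine Finset.sum_congr rfl fun q _ => ?_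
      simp only [Pi.smul_apply, Prod.smul_fst, Prod.smul_snd, smul_eq_mul]
      ring
    rw [h, ha g hg, mul_zero]

/-- The dressed logical operators `N(G) · G \ G` of the subsystem code with gauge group `G`. -/
def dressedLogicals {Q : Type*} [Fintype Q] (G : Submodule (ZMod 2) (PauliString Q)) :
    Set (PauliString Q) :=
  {L | L ∈ commutant G ⊔ G ∧ L ∉ G}

/-- The distance: the minimum weight of a dressed logical operator. It is `⊤` when there is no
such operator, i.e. when no logical qubit is encoded. -/
noncomputable def codeDistance {Q : Type*} [Fintype Q]
    (G : Submodule (ZMod 2) (PauliString Q)) : ℕ∞ :=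
  ⨅ L ∈ dressedLogicals G, (PauliString.weight L : ℕ∞)

/-- `G` is the gauge group of an `[[n, k, d]]` subsystem code. The group of bare logicals modulo
gauge operators is the Pauli group, modulo phases, of `k` qubits, so it has dimension `2 * k`
over `ZMod 2`. A stabilizer code is the special case in which `G` is the stabilizer group. -/
structure HasParameters {Q : Type*} [Fintype Q] (G : Submodule (ZMod 2) (PauliString Q))
    (n k : ℕ) (d : ℕ∞) : Prop where
  card_qubits : Fintype.card Q = n
  logical_qubits :
    Module.finrank (ZMod 2) (↥(commutant G) ⧸ G.submoduleOf (commutant G)) = 2 * k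
  distance : codeDistance G = d

/-- A stabilizer code on the qubits `Q`, presented by commuting checks labelled by `S`. -/
structure StabilizerCode (Q S : Type*) [Fintype Q] where
  check : S → PauliString Q
  commute : ∀ s t, PauliString.commutator (check s) (check t) = 0

namespace StabilizerCode

variable {Q S : Type*} [Fintype Q] [Fintype S] (C : StabilizerCode Q S)

/-- The stabilizer group, generated by the checks. -/
def stabilizer : Submodule (ZMod 2) (PauliString Q) :=
  Submodule.span (ZMod 2) (Set.range C.check)

/-- The number of qubits on which the check `s` acts. -/
def checkWeight (s : S) : ℕ := (C.check s).weight

/-- The number of checks that act on the qubit `q`. -/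
def degree (q : Q) : ℕ := (Finset.univ.filter fun s => C.check s q ≠ 0).card

/-- The number of checks that act on the qubit `q` as the Pauli operator `P`. -/
def letterDegree (q : Q) (P : PauliLetter) : ℕ :=
  (Finset.univ.filter fun s => C.check s q = P.1).card

/-- The maximum check weight `ω`. -/
def maxWeight : ℕ := Finset.univ.sup C.checkWeight

/-- The maximum qubit degree `δ`. -/
def maxDegree : ℕ := Finset.univ.sup C.degree

end StabilizerCode

/-! ### The trivalent resolution -/

/-- The choices made in a trivalent resolution: an ordering of the qubits in each check, an
ordering of the checks that act as `P` on the qubit `q`, for every `q` and every `P = X, Y, Z`,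
and the set of qubits whose degree is reduced. Only qubits of degree at most three may be left
out of the latter. -/
structure Resolution {Q S : Type*} [Fintype Q] [Fintype S] (C : StabilizerCode Q S) where
  qubitOrder : ∀ s : S, Fin (C.checkWeight s) ≃ {q : Q // C.check s q ≠ 0}
  checkOrder : ∀ (q : Q) (P : PauliLetter), Fin (C.letterDegree q P) ≃ {s : S // C.check s q = P.1}
  reduced : Finset Q
  degree_le_three : ∀ q, q ∉ reduced → C.degree q ≤ 3

namespace Resolution

variable {Q S : Type*} [Fintype Q] [DecidableEq Q] [Fintype S] [DecidableEq S]
  {C : StabilizerCode Q S} (R : Resolution C)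

/-- The number of `P`-type copy qubits of `q`: one less than the number of checks acting as `P`
on `q` (and none if this number is `0`, or if the degree of `q` is not reduced). -/
def numCopies (q : Q) (P : PauliLetter) : ℕ :=
  if q ∈ R.reduced then C.letterDegree q P - 1 else 0

/-- The qubits of the weight-reduced code: the original (data) qubits, the copy qubits, and,
for each check of weight `w`, its `w - 3` ancillary qubits (none if `w ≤ 3`). -/
abbrev Qubit : Type _ :=
  Q ⊕ (Σ x : Q × PauliLetter, Fin (R.numCopies x.1 x.2)) ⊕ (Σ s : S, Fin (C.checkWeight s - 3))

instance : DecidableEq R.Qubit := inferInstance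

/-- The original qubit `q`. -/
abbrev data (q : Q) : R.Qubit := Sum.inl q

/-- The `i`-th `P`-type copy qubit of `q`. -/
abbrev copy (q : Q) (P : PauliLetter) (i : Fin (R.numCopies q P)) : R.Qubit :=
  Sum.inr (Sum.inl ⟨(q, P), i⟩)

/-- The `j`-th ancillary qubit of the check `s`. -/
abbrev ancilla (s : S) (j : Fin (C.checkWeight s - 3)) : R.Qubit := Sum.inr (Sum.inr ⟨s, j⟩)

/-- The multi-qubit gauge checks of the weight-reduced code: for each copy qubit, the two-body
check that couples it to its predecessor, and, for each check `s` of weight `w`, the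
`max 1 (w - 2)` parts into which `s` is broken. -/
abbrev Check : Type _ :=
  (Σ x : Q × PauliLetter, Fin (R.numCopies x.1 x.2)) ⊕ (Σ s : S, Fin (C.checkWeight s - 3 + 1))

instance : DecidableEq R.Check := inferInstance

/-- For `i = 0`, the check `P_q Z_0` that couples `q` to its first `P`-type copy qubit;
for `i > 0`, the check `Z_{i-1} Z_i` that couples two consecutive copy qubits. -/
def linkCheck (q : Q) (P : PauliLetter) (i : Fin (R.numCopies q P)) : PauliString R.Qubit :=
  (if i.val = 0 then PauliString.on (R.data q) P.1
    else PauliString.on (R.copy q P ⟨i.val - 1, by omega⟩) Pauli.Z)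
  + PauliString.on (R.copy q P i) Pauli.Z

/-- How the check `s` acts, after the degree reduction, for the `a`-th qubit `q` in its support.
If `s` acts on `q` as `P` and is the `i`-th such check, then it acts as `Z` on the `i`-th `P`-type
copy qubit, where the last two such checks share the last copy qubit; if there are no copy
qubits, then `s` still acts as `P` on `q`. -/
def leg (s : S) (a : Fin (C.checkWeight s)) : PauliString R.Qubit :=
  let q : Q := (R.qubitOrder s a).1
  let P : PauliLetter := ⟨C.check s q, (R.qubitOrder s a).2⟩
  let i : Fin (C.letterDegree q P) := (R.checkOrder q P).symm ⟨s, rfl⟩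
  if h : R.numCopies q P = 0 then PauliString.on (R.data q) P.1
  else PauliString.on (R.copy q P ⟨min i.val (R.numCopies q P - 1), by omega⟩) Pauli.Z

/-- The parts of a check of weight `w` with legs `P_0, …, P_{w-1}` and ancillary qubits
`0, …, w - 4` are `P_0 P_1 Z_0`, `Z_0 P_2 Z_1`, …, `Z_{w-5} P_{w-3} Z_{w-4}`,
`Z_{w-4} P_{w-2} P_{w-1}`. For `w ≤ 3` the only part is the product of all the legs. -/
def partCheck (s : S) (j : Fin (C.checkWeight s - 3 + 1)) : PauliString R.Qubit :=
  (∑ a : Fin (C.checkWeight s) with min (a.val - 1) (C.checkWeight s - 3) = j.val, R.leg s a)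
  + ∑ i : Fin (C.checkWeight s - 3) with i.val = j.val ∨ i.val + 1 = j.val,
      PauliString.on (R.ancilla s i) Pauli.Z

/-- The multi-qubit gauge checks of the weight-reduced code, as Pauli operators. Their Tanner
graph is the trivalent resolution of the Tanner graph of the code. -/
def check : R.Check → PauliString R.Qubit
  | Sum.inl x => R.linkCheck x.1.1 x.1.2 x.2
  | Sum.inr x => R.partCheck x.1 x.2

end Resolution

/-! ### Embeddings of Tanner graphs -/

/-- The edges of the Tanner graph of a family of checks: pairs of a check and a qubit on which it
acts non-trivially. The vertices of the Tanner graph are the qubits and the checks. -/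
abbrev TannerEdge {A K : Type*} (check : K → PauliString A) : Type _ :=
  {x : K × A // check x.1 x.2 ≠ 0}

/-- A `c`-to-one embedding of the Tanner graph of a family of checks into the graph `G`: vertices
are sent to vertices, edges are sent to paths of positive length between the images of their
endpoints, at most `c` vertices are sent to the same vertex, and the paths of at most `c` edges
go through the same edge. -/
structure TannerEmbedding {A K V : Type*} (check : K → PauliString A) (G : SimpleGraph V)
    (c : ℕ) where
  node : A ⊕ K → V
  path : ∀ e : TannerEdge check, G.Walk (node (Sum.inl e.1.2)) (node (Sum.inr e.1.1))
  isPath : ∀ e, (path e).IsPath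
  length_pos : ∀ e, 0 < (path e).length
  vertex_load : ∀ v : V, {x | node x = v}.ncard ≤ c
  edge_load : ∀ f ∈ G.edgeSet, {e | f ∈ (path e).edges}.ncard ≤ c

namespace TannerEmbedding

variable {A K V : Type*} {check : K → PauliString A} {G : SimpleGraph V} {c : ℕ}

/-- The length assigned to an edge of the Tanner graph: the length of its path. -/
def length (φ : TannerEmbedding check G c) (e : TannerEdge check) : ℕ := (φ.path e).length

/-- The longest edge length. -/
def maxLength [Fintype A] [Fintype K] (φ : TannerEmbedding check G c) : ℕ :=
  Finset.univ.sup φ.length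

end TannerEmbedding

/-! ### Edge extension -/

section EdgeExtension

variable {A K : Type*} [Fintype A] [DecidableEq A] [Fintype K] [DecidableEq K]
  (check : K → PauliString A) (len : TannerEdge check → ℕ)

/-- The qubits after edge extension: each edge of length `ℓ` carries `ℓ - 1` additional ones. -/
abbrev ExtQubit : Type _ := A ⊕ (Σ e : TannerEdge check, Fin (len e - 1))

instance : DecidableEq (ExtQubit check len) := inferInstance

/-- The operators along the wire that replaces an edge `e` from a qubit `q` to a check `x`:
at position `0` the Pauli operator with which `x` acts on `q`, at position `t + 1` the operator
`Z` on the `t`-th additional qubit of `e`. -/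
def wireOp (e : TannerEdge check) : ℕ → PauliString (ExtQubit check len)
  | 0 => PauliString.on (Sum.inl e.1.2) (check e.1.1 e.1.2)
  | t + 1 => if h : t < len e - 1 then PauliString.on (Sum.inr ⟨e, ⟨t, h⟩⟩) Pauli.Z else 0

/-- The multi-qubit checks after edge extension. The check `x` now acts on the last qubit of each
of its wires; consecutive qubits on a wire are coupled by the two-body checks
`P_q Z_0`, `Z_0 Z_1`, …, `Z_{ℓ-3} Z_{ℓ-2}`. -/
def extCheck : K ⊕ (Σ e : TannerEdge check, Fin (len e - 1)) → PauliString (ExtQubit check len)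
  | Sum.inl x => ∑ e : TannerEdge check with e.1.1 = x, wireOp check len e (len e - 1)
  | Sum.inr y => wireOp check len y.1 y.2.val + wireOp check len y.1 (y.2.val + 1)

end EdgeExtension

/-! ### The wire code -/

namespace Resolution

variable {Q S : Type*} [Fintype Q] [DecidableEq Q] [Fintype S] [DecidableEq S]
  {C : StabilizerCode Q S} (R : Resolution C) (len : TannerEdge R.check → ℕ)

/-- The qubits of the edge-extended wire code. -/
abbrev WireQubit : Type _ := ExtQubit R.check len

/-- The gauge checks of the edge-extended wire code with edge lengths `len`: the multi-qubit
checks, and a single-qubit check `X` on every qubit that is not an original qubit. -/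
def wireChecks : Set (PauliString (R.WireQubit len)) :=
  Set.range (extCheck R.check len) ∪
    {p | ∃ x : R.WireQubit len, (∀ q : Q, x ≠ Sum.inl (R.data q)) ∧ p = PauliString.on x Pauli.X}

/-- The gauge group of the edge-extended wire code. -/
def wireGauge : Submodule (ZMod 2) (PauliString (R.WireQubit len)) :=
  Submodule.span (ZMod 2) (R.wireChecks len)

end Resolution

/-! ### Locality and density on a graph -/

/-- The places of a graph at which qubits can be located: its vertices and its edges. -/
abbrev Site {V : Type*} (G : SimpleGraph V) : Type _ := V ⊕ G.edgeSet

/-- A place is near the vertex `v` if it is `v` itself, a neighbour of `v`, or an edge incident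
to `v`. -/
def Site.Near {V : Type*} {G : SimpleGraph V} (v : V) : Site G → Prop
  | Sum.inl u => u = v ∨ G.Adj v u
  | Sum.inr f => v ∈ f.1

/-- The checks are local on `G`, for the given locations of the qubits: every check acts only on
qubits near some vertex. -/
def IsLocalOn {A V : Type*} (G : SimpleGraph V) (site : A → Site G)
    (checks : Set (PauliString A)) : Prop :=
  ∀ p ∈ checks, ∃ v : V, ∀ x, p x ≠ 0 → Site.Near v (site x)

/-- At most `c` qubits are located at each vertex and at each edge of `G`. -/
def HasDensityAtMost {A V : Type*} (G : SimpleGraph V) (site : A → Site G) (c : ℕ) : Prop :=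
  ∀ y : Site G, {x | site x = y}.ncard ≤ c

/-- The locations of the qubits after edge extension along an embedding: the qubits of the
embedded Tanner graph are at their images, and, if the path of `e` is `p_0, …, p_ℓ`, the `t`-th
additional qubit of `e` (`t = 0, …, ℓ - 2`) is on the edge from `p_{t+1}` to `p_{t+2}`. -/
def TannerEmbedding.site {A K V : Type*} {check : K → PauliString A} {G : SimpleGraph V} {c : ℕ}
    (φ : TannerEmbedding check G c) : ExtQubit check φ.length → Site G
  | Sum.inl x => Sum.inl (φ.node (Sum.inl x))
  | Sum.inr y => Sum.inr
      ⟨s((φ.path y.1).getVert (y.2.val + 1), (φ.path y.1).getVert (y.2.val + 1 + 1)), by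
        have h := y.2.isLt
        have h' : φ.length y.1 = (φ.path y.1).length := rfl
        exact (φ.path y.1).adj_getVert_succ (by omega)⟩

/-! ### Retractions of Pauli groups onto a subset of the qubits -/

section Retraction

variable {A B : Type*}

/-! The resolution and the edge extension are two instances of one mechanism. Qubits `B` are added
to qubits `A`; every new qubit `b` carries the gauge operator `X`, and chains of checks make `Z` on
`b` gauge-equivalent to a Pauli operator `T b` on `A`. Let ρ be the linear map that forgets `X` on
`b` and replaces `Z` by `T b` (`retraction`). Every operator is gauge-equivalent to its image under
ρ, so the large gauge group is the full preimage of its image H (`eq_comap_retraction`).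

The rest is linear algebra. The adjoint of ρ for the commutator pairing (`bareLift`) is a section of
ρ and carries the commutant of H onto that of the preimage (`commutant_comap_retraction`). Hence the
logical dimension is unchanged and ρ maps dressed logicals to dressed logicals. It multiplies
weights by at most the largest weight of the `T b`, or by 1 if that is smaller.

On a wire, `T` is a single-qubit operator, so edge extension costs nothing in distance. In the
resolution, `T` is a single-qubit operator on a copy qubit and a partial product of a check on an
ancilla, of weight at most ω; this is the factor lost in `d ≤ ω d'`. The image of the resolved gauge
group is the stabilizer group because the parts of a check telescope (`retraction_partCheck`).

The qubit count follows by double counting the incidences of checks and qubits. Locality and density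
are read off the paths, each of which uses an edge of the graph at most once. -/

theorem PauliString.commutator_add_right [Fintype A] (p a b : PauliString A) :
    PauliString.commutator p (a + b) = PauliString.commutator p a + PauliString.commutator p b := by
  simp only [PauliString.commutator, ← Finset.sum_add_distrib]
  refine Finset.sum_congr rfl fun q _ => ?_
  simp only [Pi.add_apply, Prod.fst_add, Prod.snd_add]
  ring

theorem PauliString.commutator_smul_right [Fintype A] (t : ZMod 2) (p a : PauliString A) :
    PauliString.commutator p (t • a) = t * PauliString.commutator p a := by
  simp only [PauliString.commutator, Finset.mul_sum]
  refine Finset.sum_congr rfl fun q _ => ?_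
  simp only [Pi.smul_apply, Prod.smul_fst, Prod.smul_snd, smul_eq_mul]
  ring

theorem PauliString.commutator_comm [Fintype A] (p a : PauliString A) :
    PauliString.commutator p a = PauliString.commutator a p := by
  refine Finset.sum_congr rfl fun q _ => ?_
  ring

theorem PauliString.commutator_on [Fintype A] [DecidableEq A] (p : PauliString A) (a : A)
    (P : Pauli) :
    PauliString.commutator p (PauliString.on a P) = (p a).1 * P.2 + (p a).2 * P.1 := by
  rw [PauliString.commutator, Finset.sum_eq_single a]
  · simp [PauliString.on]
  · intro b _ hb
    simp [PauliString.on, Pi.single_eq_of_ne hb]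
  · simp

/-- Commutation with a fixed Pauli operator, as a linear form. -/
def PauliString.commutatorForm [Fintype A] (p : PauliString A) :
    PauliString A →ₗ[ZMod 2] ZMod 2 where
  toFun := PauliString.commutator p
  map_add' := PauliString.commutator_add_right p
  map_smul' t a := PauliString.commutator_smul_right t p a

theorem PauliString.add_self (p : PauliString A) : p + p = 0 := by
  funext a
  exact Prod.ext (CharTwo.add_self_eq_zero _) (CharTwo.add_self_eq_zero _)

theorem PauliString.on_add [DecidableEq A] (a : A) (P P' : Pauli) :
    PauliString.on a (P + P') = PauliString.on a P + PauliString.on a P' :=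
  Pi.single_add (f := fun _ => Pauli) a P P'

theorem PauliString.on_smul [DecidableEq A] (t : ZMod 2) (a : A) (P : Pauli) :
    PauliString.on a (t • P) = t • PauliString.on a P :=
  Pi.single_smul (f := fun _ => Pauli) a t P

theorem PauliString.sum_on [Fintype A] [DecidableEq A] (p : PauliString A) :
    ∑ a, PauliString.on a (p a) = p :=
  Finset.univ_sum_single p

theorem Pauli.eq_smul_add_smul (P : Pauli) : P = P.1 • Pauli.X + P.2 • Pauli.Z := by
  ext <;> simp [Pauli.X, Pauli.Z]

/-- A Pauli operator on the qubits `A`, acting trivially on the qubits `B`. -/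
def PauliString.extend : PauliString A →ₗ[ZMod 2] PauliString (A ⊕ B) where
  toFun p := Sum.elim p 0
  map_add' p r := by
    funext x
    cases x <;> simp
  map_smul' t p := by
    funext x
    cases x <;> simp

theorem PauliString.extend_on [DecidableEq A] [DecidableEq (A ⊕ B)] (a : A) (P : Pauli) :
    (PauliString.on a P).extend (B := B) = PauliString.on (Sum.inl a) P := by
  funext x
  rcases x with b | b
  · by_cases h : b = a
    · subst h
      simp [PauliString.extend, PauliString.on]
    · have h' : (Sum.inl b : A ⊕ B) ≠ Sum.inl a := fun e => h (Sum.inl.inj e)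
      simp [PauliString.extend, PauliString.on, Pi.single_eq_of_ne h, Pi.single_eq_of_ne h']
  · simp [PauliString.extend, PauliString.on]

/-- The retraction of the Pauli group of `A ⊕ B` onto that of `A` that deletes `X` on every
qubit `b : B` and replaces `Z` by `T b`. -/
def retraction [Fintype B] (T : B → PauliString A) :
    PauliString (A ⊕ B) →ₗ[ZMod 2] PauliString A where
  toFun p := (fun a => p (Sum.inl a)) + ∑ b, (p (Sum.inr b)).2 • T b
  map_add' p r := by
    have h : ∑ b, ((p + r) (Sum.inr b)).2 • T b
        = ∑ b, (p (Sum.inr b)).2 • T b + ∑ b, (r (Sum.inr b)).2 • T b := by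
      rw [← Finset.sum_add_distrib]
      exact Finset.sum_congr rfl fun b _ => add_smul _ _ _
    rw [h, add_add_add_comm]
    rfl
  map_smul' t p := by
    have h : ∑ b, ((t • p) (Sum.inr b)).2 • T b = t • ∑ b, (p (Sum.inr b)).2 • T b := by
      rw [Finset.smul_sum]
      exact Finset.sum_congr rfl fun b _ => mul_smul _ _ _
    rw [h, RingHom.id_apply, smul_add]
    rfl

theorem retraction_apply [Fintype B] (T : B → PauliString A) (p : PauliString (A ⊕ B)) :
    retraction T p = (fun a => p (Sum.inl a)) + ∑ b, (p (Sum.inr b)).2 • T b :=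
  rfl

theorem retraction_extend [Fintype B] (T : B → PauliString A) (p : PauliString A) :
    retraction T p.extend = p := by
  funext a
  simp [retraction, PauliString.extend]

theorem retraction_on_inl [Fintype B] [DecidableEq A] [DecidableEq (A ⊕ B)]
    (T : B → PauliString A) (a : A) (P : Pauli) : retraction T (PauliString.on (Sum.inl a) P) = PauliString.on a P := by
  rw [← PauliString.extend_on, retraction_extend]

theorem retraction_on_inr [Fintype B] [DecidableEq (A ⊕ B)] (T : B → PauliString A) (b : B)
    (P : Pauli) : retraction T (PauliString.on (Sum.inr b) P) = P.2 • T b := by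
  rw [retraction_apply, Finset.sum_eq_single b]
  · funext a
    simp [PauliString.on]
  · intro b' _ hb
    have h' : (Sum.inr b' : A ⊕ B) ≠ Sum.inr b := fun e => hb (Sum.inr.inj e)
    simp [PauliString.on, Pi.single_eq_of_ne h']
  · simp

theorem retraction_on_inr_X [Fintype B] [DecidableEq (A ⊕ B)] (T : B → PauliString A) (b : B) :
    retraction T (PauliString.on (Sum.inr b) Pauli.X) = 0 := by
  simp [retraction_on_inr, Pauli.X]

theorem retraction_on_inr_Z [Fintype B] [DecidableEq (A ⊕ B)] (T : B → PauliString A) (b : B) :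
    retraction T (PauliString.on (Sum.inr b) Pauli.Z) = T b := by
  simp [retraction_on_inr, Pauli.Z]

/-- If `G` contains `X` and `Z * T b` on every additional qubit `b`, then every Pauli operator is
`G`-equivalent to its retraction. -/
theorem add_extend_retraction_mem [Fintype A] [Fintype B] [DecidableEq (A ⊕ B)] {T : B → PauliString A}
    {G : Submodule (ZMod 2) (PauliString (A ⊕ B))}
    (hX : ∀ b, PauliString.on (Sum.inr b) Pauli.X ∈ G)
    (hZ : ∀ b, PauliString.on (Sum.inr b) Pauli.Z + (T b).extend ∈ G)
    (p : PauliString (A ⊕ B)) : p + (retraction T p).extend ∈ G := by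
  classical
  let f : PauliString (A ⊕ B) →ₗ[ZMod 2] PauliString (A ⊕ B) :=
    LinearMap.id + PauliString.extend ∘ₗ retraction T
  change f p ∈ G
  rw [← PauliString.sum_on p, map_sum]
  refine Submodule.sum_mem _ fun x _ => ?_
  rcases x with a | b
  · have : f (PauliString.on (Sum.inl a) (p (Sum.inl a))) = 0 := by
      simp only [f, LinearMap.add_apply, LinearMap.id_apply, LinearMap.comp_apply,
        retraction_on_inl, PauliString.extend_on, PauliString.add_self]
    rw [this]
    exact G.zero_mem
  · rw [Pauli.eq_smul_add_smul (p (Sum.inr b)), PauliString.on_add, PauliString.on_smul,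
      PauliString.on_smul, map_add, map_smul, map_smul]
    refine G.add_mem (G.smul_mem _ ?_) (G.smul_mem _ ?_)
    · simpa [f, retraction_on_inr_X] using hX b
    · simpa [f, retraction_on_inr_Z] using hZ b

/-- If `p` has the same retraction as some `g` in `G`, both are `G`-equivalent to that one operator,
hence to each other. -/
theorem eq_comap_retraction [Fintype A] [Fintype B] [DecidableEq (A ⊕ B)] {T : B → PauliString A}
    {G : Submodule (ZMod 2) (PauliString (A ⊕ B))} {H : Submodule (ZMod 2) (PauliString A)}
    (hX : ∀ b, PauliString.on (Sum.inr b) Pauli.X ∈ G)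
    (hZ : ∀ b, PauliString.on (Sum.inr b) Pauli.Z + (T b).extend ∈ G)
    (hmap : G.map (retraction T) = H) : G = H.comap (retraction T) := by
  refine le_antisymm (hmap ▸ Submodule.le_comap_map _ _) fun p hp => ?_
  rw [Submodule.mem_comap, ← hmap] at hp
  obtain ⟨g, hg, hgp⟩ := hp
  have h := G.add_mem (add_extend_retraction_mem hX hZ p)
    (G.add_mem (add_extend_retraction_mem hX hZ g) hg)
  rw [hgp] at h
  have e : p + (retraction T p).extend + (g + (retraction T p).extend + g) =
      p + ((retraction T p).extend + (retraction T p).extend) + (g + g) := by abel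
  rwa [e, PauliString.add_self, PauliString.add_self, add_zero, add_zero] at h

/-- The adjoint of `retraction T` for the commutator pairing. -/
def bareLift [Fintype A] (T : B → PauliString A) : PauliString A →ₗ[ZMod 2] PauliString (A ⊕ B) where
  toFun p := Sum.elim p fun b => (PauliString.commutator p (T b), 0)
  map_add' p r := by
    funext x
    rcases x with a | b
    · rfl
    · refine Prod.ext ?_ (by simp)
      simp only [PauliString.commutator_comm _ (T b), PauliString.commutator_add_right,
        Sum.elim_inr, Pi.add_apply, Prod.fst_add]
  map_smul' t p := by
    funext x
    rcases x with a | b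
    · rfl
    · refine Prod.ext ?_ (by simp)
      simp only [PauliString.commutator_comm _ (T b), PauliString.commutator_smul_right,
        Sum.elim_inr, Pi.smul_apply, Prod.smul_fst, RingHom.id_apply, smul_eq_mul]

theorem retraction_bareLift [Fintype A] [Fintype B] (T : B → PauliString A) (p : PauliString A) :
    retraction T (bareLift T p) = p := by
  funext a
  simp [retraction, bareLift]

/-- The `X` part of the lift at `b` records whether `p` anticommutes with `T b`, which is what `Z`
on `b` must detect once it is replaced by `T b`. -/
theorem commutator_bareLift [Fintype A] [Fintype B] (T : B → PauliString A) (p : PauliString A)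
    (r : PauliString (A ⊕ B)) :
    PauliString.commutator (bareLift T p) r = PauliString.commutator p (retraction T r) := by
  rw [retraction_apply, PauliString.commutator_add_right]
  change _ = _ + p.commutatorForm _
  rw [map_sum]
  simp only [map_smul]
  simp [PauliString.commutator, PauliString.commutatorForm, bareLift, mul_comm]

/-- The preimage contains `X` on each `b`, which rules out a `Z` part there, and `Z` on `b` times `T
b`, which forces the `X` part to be that of `bareLift`. It also contains `H` itself, so the
restriction to `A` commutes with `H`. The converse is adjointness. -/
theorem commutant_comap_retraction [Fintype A] [Fintype B] (T : B → PauliString A)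
    (H : Submodule (ZMod 2) (PauliString A)) :
    commutant (H.comap (retraction T)) = (commutant H).map (bareLift T) := by
  classical
  ext p
  constructor
  · intro hp
    have hX : ∀ b, (p (Sum.inr b)).2 = 0 := fun b => by
      have h := hp (PauliString.on (Sum.inr b) Pauli.X)
        (by rw [Submodule.mem_comap, retraction_on_inr_X]; exact H.zero_mem)
      simpa [PauliString.commutator_on, Pauli.X] using h
    have hext : ∀ r : PauliString A, PauliString.commutator p r.extend
        = PauliString.commutator (fun a => p (Sum.inl a)) r := fun r => by
      simp [PauliString.commutator, PauliString.extend]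
    refine ⟨fun a => p (Sum.inl a), fun h hh => ?_, ?_⟩
    · rw [← hext]
      exact hp _ (by rwa [Submodule.mem_comap, retraction_extend])
    · funext x
      rcases x with a | b
      · rfl
      · refine Prod.ext ?_ (hX b).symm
        have h := hp (PauliString.on (Sum.inr b) Pauli.Z + (T b).extend) (by
          rw [Submodule.mem_comap, map_add, retraction_on_inr_Z, retraction_extend,
            PauliString.add_self]
          exact H.zero_mem)
        rw [PauliString.commutator_add_right, hext, PauliString.commutator_on] at h
        have h' : (p (Sum.inr b)).1 + PauliString.commutator (fun a => p (Sum.inl a)) (T b) = 0 := by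
          simpa [Pauli.Z] using h
        exact (CharTwo.add_eq_zero.1 h').symm
  · rintro ⟨r, hr, rfl⟩ g hg
    rw [commutator_bareLift]
    exact hr _ hg

/-- `bareLift` is an isomorphism of commutants. Being a section of the retraction, it sends an
operator into the preimage exactly when that operator lies in `H`. -/
theorem finrank_logical_comap_retraction [Fintype A] [Fintype B] (T : B → PauliString A)
    (H : Submodule (ZMod 2) (PauliString A)) :
    Module.finrank (ZMod 2) (↥(commutant (H.comap (retraction T))) ⧸
        (H.comap (retraction T)).submoduleOf (commutant (H.comap (retraction T)))) =
      Module.finrank (ZMod 2) (↥(commutant H) ⧸ H.submoduleOf (commutant H)) := by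
  have hinj : Function.Injective (bareLift T) :=
    Function.LeftInverse.injective (retraction_bareLift T)
  let e : ↥(commutant H) ≃ₗ[ZMod 2] ↥(commutant (H.comap (retraction T))) :=
    (Submodule.equivMapOfInjective _ hinj _).trans
      (LinearEquiv.ofEq _ _ (commutant_comap_retraction T H).symm)
  have he : ∀ v, (e v : PauliString (A ⊕ B)) = bareLift T v := fun v => rfl
  refine (LinearEquiv.finrank_eq (Submodule.Quotient.equiv _ _ e ?_)).symm
  ext v
  obtain ⟨v, rfl⟩ := e.surjective v
  simp only [Submodule.submoduleOf, Submodule.mem_map, Submodule.mem_comap, Submodule.subtype_apply,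
    he, retraction_bareLift]
  constructor
  · rintro ⟨u, hu, huv⟩
    rw [← e.injective huv]
    exact hu
  · exact fun h => ⟨v, h, rfl⟩

theorem retraction_mem_dressedLogicals [Fintype A] [Fintype B] {T : B → PauliString A}
    {H : Submodule (ZMod 2) (PauliString A)} {L : PauliString (A ⊕ B)}
    (hL : L ∈ dressedLogicals (H.comap (retraction T))) : retraction T L ∈ dressedLogicals H := by
  refine ⟨?_, hL.2⟩
  obtain ⟨p, hp, g, hg, rfl⟩ := Submodule.mem_sup.1 hL.1
  rw [commutant_comap_retraction] at hp
  obtain ⟨r, hr, rfl⟩ := hp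
  rw [map_add, retraction_bareLift]
  exact Submodule.add_mem_sup hr hg

/-! ### Weights -/

theorem PauliString.weight_eq_sum [Fintype A] (p : PauliString A) :
    p.weight = ∑ a, if p a ≠ 0 then 1 else 0 :=
  Finset.card_filter _ _

theorem PauliString.weight_add_le [Fintype A] (p r : PauliString A) :
    (p + r).weight ≤ p.weight + r.weight := by
  classical
  refine le_trans (Finset.card_le_card ?_) (Finset.card_union_le _ _)
  intro a ha
  simp only [Finset.mem_union, Finset.mem_filter, Finset.mem_univ, true_and, Pi.add_apply] at ha ⊢
  by_contra! h
  exact ha (by rw [h.1, h.2, add_zero])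

theorem PauliString.weight_zero [Fintype A] : (0 : PauliString A).weight = 0 := by
  simp [PauliString.weight]

theorem PauliString.weight_sum_le [Fintype A] {I : Type*} (s : Finset I) (f : I → PauliString A) :
    (∑ i ∈ s, f i).weight ≤ ∑ i ∈ s, (f i).weight :=
  Finset.le_sum_of_subadditive _ PauliString.weight_zero.le PauliString.weight_add_le _ _

theorem PauliString.weight_on_le [Fintype A] [DecidableEq A] (a : A) (P : Pauli) :
    (PauliString.on a P).weight ≤ 1 := by
  refine le_trans (Finset.card_le_card (t := {a}) fun b hb => ?_) (Finset.card_singleton a).le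
  rw [Finset.mem_singleton]
  by_contra h
  exact (Finset.mem_filter.1 hb).2 (Pi.single_eq_of_ne (M := fun _ => Pauli) h P)

theorem weight_retraction_le [Fintype A] [Fintype B] {T : B → PauliString A} {W : ℕ} (hW : 1 ≤ W)
    (hT : ∀ b, (T b).weight ≤ W) (p : PauliString (A ⊕ B)) :
    (retraction T p).weight ≤ W * p.weight := by
  rw [retraction_apply, p.weight_eq_sum, Fintype.sum_sum_type, mul_add, Finset.mul_sum,
    Finset.mul_sum]
  refine (PauliString.weight_add_le _ _).trans (add_le_add ?_ ?_)
  · rw [PauliString.weight_eq_sum]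
    exact Finset.sum_le_sum fun a _ => Nat.le_mul_of_pos_left _ hW
  · refine (PauliString.weight_sum_le _ _).trans (Finset.sum_le_sum fun b _ => ?_)
    by_cases h : (p (Sum.inr b)).2 = 0
    · rw [h, zero_smul, PauliString.weight_zero]
      exact Nat.zero_le _
    · have h1 : (p (Sum.inr b)).2 = 1 := Fin.eq_one_of_ne_zero _ h
      have h0 : p (Sum.inr b) ≠ 0 := fun e => h (by rw [e]; rfl)
      rw [if_pos h0, mul_one, h1, one_smul]
      exact hT b

theorem codeDistance_le_mul [Fintype A] [Fintype B] {G : Submodule (ZMod 2) (PauliString B)}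
    {H : Submodule (ZMod 2) (PauliString A)} {W : ℕ} (hW : 1 ≤ W)
    (f : PauliString B → PauliString A) (hf : ∀ L ∈ dressedLogicals G, f L ∈ dressedLogicals H)
    (hweight : ∀ L, (f L).weight ≤ W * L.weight) :
    codeDistance H ≤ W * codeDistance G := by
  have hW0 : (W : ℕ∞) ≠ 0 := by exact_mod_cast (show W ≠ 0 by omega)
  rw [codeDistance.eq_1 G]
  by_cases hne : (dressedLogicals G).Nonempty
  · obtain ⟨L, hL, hmin⟩ := exists_minimalFor_of_wellFoundedLT (· ∈ dressedLogicals G)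
      PauliString.weight hne
    have hle : (L.weight : ℕ∞) ≤ ⨅ L ∈ dressedLogicals G, (PauliString.weight L : ℕ∞) :=
      le_iInf₂ fun M hM => by
        rcases le_total L.weight M.weight with h | h
        · exact_mod_cast h
        · exact_mod_cast hmin hM h
    calc codeDistance H ≤ ((f L).weight : ℕ∞) := iInf₂_le _ (hf L hL)
      _ ≤ W * L.weight := by exact_mod_cast hweight L
      _ ≤ _ := by gcongr
  -- Without dressed logicals the distance is `⊤`, and `W ≠ 0` keeps the product at `⊤`.
  · have : (⨅ L ∈ dressedLogicals G, (PauliString.weight L : ℕ∞)) = ⊤ := by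
      simp only [iInf_eq_top]
      exact fun L hL => absurd ⟨L, hL⟩ hne
    rw [this, ENat.mul_top hW0]
    exact le_top

end Retraction

/-! ### The resolution as a retraction -/

/-- Both terms are one function of an index, evaluated at `j` and `j + 1`; the unsimplified `j + 1 -
1` makes them match `linkOp` definitionally. -/
theorem Fin.sum_filter_eq_or_succ_eq {M : Type*} [AddCommMonoid M] {m : ℕ} (j : ℕ)
    (f : Fin m → M) :
    ∑ i : Fin m with i.val = j ∨ i.val + 1 = j, f i =
      (if h : 0 < j ∧ j - 1 < m then f ⟨j - 1, h.2⟩ else 0)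
        + if h : 0 < j + 1 ∧ j + 1 - 1 < m then f ⟨j + 1 - 1, h.2⟩ else 0 := by
  have single : ∀ k, ∑ i : Fin m with 0 < k ∧ i.val = k - 1, f i
      = if h : 0 < k ∧ k - 1 < m then f ⟨k - 1, h.2⟩ else 0 := fun k => by
    split_ifs with h
    · rw [← Finset.sum_singleton f ⟨k - 1, h.2⟩]
      refine Finset.sum_congr ?_ fun _ _ => rfl
      ext i
      simp [Fin.ext_iff, h.1]
    · refine Finset.sum_eq_zero fun i hi => absurd ?_ h
      have := (Finset.mem_filter.1 hi).2
      omega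
  rw [← single, ← single, ← Finset.sum_union]
  · refine Finset.sum_congr ?_ fun _ _ => rfl
    ext i
    simp only [Finset.mem_filter, Finset.mem_univ, true_and, Finset.mem_union]
    omega
  · rw [Finset.disjoint_filter]
    intro i _
    omega

namespace Resolution

set_option linter.unusedSectionVars false

variable {Q S : Type*} [Fintype Q] [DecidableEq Q] [Fintype S] [DecidableEq S]
  {C : StabilizerCode Q S} (R : Resolution C)

/-- The restriction of the check `s` to the `a`-th qubit of its support. -/
def factor (s : S) (a : Fin (C.checkWeight s)) : PauliString Q :=
  PauliString.on (R.qubitOrder s a).1 (C.check s (R.qubitOrder s a).1)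

/-- The operators on the original qubits to which `Z` on an additional qubit is equivalent:
`P` on `q` for a `P`-type copy qubit of `q`, and, for an ancillary qubit of a check, the product
of the factors of the check that precede it. -/
def anchor :
    (Σ x : Q × PauliLetter, Fin (R.numCopies x.1 x.2)) ⊕ (Σ s : S, Fin (C.checkWeight s - 3)) →
      PauliString Q
  | Sum.inl x => PauliString.on x.1.1 x.1.2.1
  | Sum.inr x =>
      -- For weight at least 4, `min (a - 1) (w - 3)` is the part containing leg `a`: truncated
      -- subtraction puts legs 0 and 1 in part 0, and the minimum puts the last two legs in part `w
      -- - 3`. For smaller weight it is always 0.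
      ∑ a : Fin (C.checkWeight x.1) with min (a.val - 1) (C.checkWeight x.1 - 3) ≤ x.2.val,
        R.factor x.1 a

/-- The gauge group of the weight-reduced code. -/
def gauge : Submodule (ZMod 2) (PauliString R.Qubit) :=
  Submodule.span (ZMod 2)
    (Set.range R.check ∪ Set.range fun r => PauliString.on (Sum.inr r) Pauli.X)

theorem sum_factor (s : S) : ∑ a, R.factor s a = C.check s := by
  calc ∑ a, R.factor s a
      = ∑ q : {q : Q // C.check s q ≠ 0}, PauliString.on q.1 (C.check s q.1) :=
        Equiv.sum_comp (R.qubitOrder s) fun q => PauliString.on q.1 (C.check s q.1)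
    _ = ∑ q with C.check s q ≠ 0, PauliString.on q (C.check s q) :=
        (Finset.sum_subtype (Finset.univ.filter fun q => C.check s q ≠ 0) (by simp)
          fun q => PauliString.on q (C.check s q)).symm
    _ = ∑ q, PauliString.on q (C.check s q) := by
        refine Finset.sum_filter_of_ne fun q _ h hq => h ?_
        rw [hq]
        exact Pi.single_zero q
    _ = C.check s := PauliString.sum_on _

theorem check_mem_gauge (x : R.Check) : R.check x ∈ R.gauge :=
  Submodule.subset_span (Or.inl ⟨x, rfl⟩)

theorem on_X_mem_gauge (r) : PauliString.on (Sum.inr r) Pauli.X ∈ R.gauge :=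
  Submodule.subset_span (Or.inr ⟨r, rfl⟩)

theorem retraction_linkCheck (q : Q) (P : PauliLetter) (i : Fin (R.numCopies q P)) :
    retraction R.anchor (R.linkCheck q P i) = 0 := by
  have h : ∀ i, retraction R.anchor (PauliString.on (R.copy q P i) Pauli.Z)
      = PauliString.on q P.1 := fun i => retraction_on_inr_Z _ _
  rw [linkCheck, map_add, h]
  split_ifs
  · rw [retraction_on_inl, PauliString.add_self]
  · rw [h, PauliString.add_self]

theorem retraction_leg (s : S) (a : Fin (C.checkWeight s)) :
    retraction R.anchor (R.leg s a) = R.factor s a := by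
  rw [leg]
  split_ifs
  · rw [retraction_on_inl, factor]
  · rw [retraction_on_inr_Z, anchor, factor]

/-- The product of the factors of `s` in the parts before the `j`-th. -/
def prefixOp (s : S) (j : ℕ) : PauliString Q :=
  ∑ a : Fin (C.checkWeight s) with min (a.val - 1) (C.checkWeight s - 3) < j, R.factor s a

theorem prefixOp_succ (s : S) (j : ℕ) :
    R.prefixOp s (j + 1) = R.prefixOp s j
      + ∑ a : Fin (C.checkWeight s) with min (a.val - 1) (C.checkWeight s - 3) = j,
          R.factor s a := by
  rw [prefixOp, prefixOp, ← Finset.sum_union]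
  · refine Finset.sum_congr ?_ fun _ _ => rfl
    ext a
    simp only [Finset.mem_filter, Finset.mem_univ, true_and, Finset.mem_union]
    omega
  · rw [Finset.disjoint_filter]
    intro a _
    omega

theorem prefixOp_zero (s : S) : R.prefixOp s 0 = 0 := by
  simp [prefixOp]

theorem prefixOp_last (s : S) : R.prefixOp s (C.checkWeight s - 3 + 1) = C.check s := by
  rw [prefixOp, Finset.filter_true_of_mem fun a _ => by omega, sum_factor]

theorem anchor_ancilla (s : S) (j : Fin (C.checkWeight s - 3)) :
    R.anchor (Sum.inr ⟨s, j⟩) = R.prefixOp s (j.val + 1) := by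
  simp only [anchor, prefixOp, Nat.lt_succ_iff]

/-- The operator `Z` on the ancillary qubit between the parts `j - 1` and `j` of the check `s`,
if there is one. -/
def linkOp (s : S) (j : ℕ) : PauliString R.Qubit :=
  if h : 0 < j ∧ j - 1 < C.checkWeight s - 3 then
    PauliString.on (R.ancilla s ⟨j - 1, h.2⟩) Pauli.Z else 0

theorem partCheck_eq (s : S) (j : Fin (C.checkWeight s - 3 + 1)) :
    R.partCheck s j =
      (∑ a : Fin (C.checkWeight s) with min (a.val - 1) (C.checkWeight s - 3) = j.val, R.leg s a)
        + (R.linkOp s j + R.linkOp s (j + 1)) := by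
  rw [partCheck, Fin.sum_filter_eq_or_succ_eq]
  rfl

/-- The bound on `j` excludes the position after the last part, where there is no ancilla but the
prefix is the whole check. -/
theorem retraction_linkOp (s : S) {j : ℕ} (hj : j ≤ C.checkWeight s - 3) :
    retraction R.anchor (R.linkOp s j) = R.prefixOp s j := by
  rw [linkOp]
  split_ifs with h
  · rw [retraction_on_inr_Z, anchor_ancilla, Nat.sub_add_cancel h.1]
  · obtain rfl : j = 0 := by omega
    rw [map_zero, prefixOp_zero]

/-- Telescoping: the incoming ancilla contributes the prefix up to `j`, the legs extend it by one
part, and the outgoing ancilla cancels the result. The last part has no outgoing ancilla, so the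
whole check survives. -/
theorem retraction_partCheck (s : S) (j : Fin (C.checkWeight s - 3 + 1)) :
    retraction R.anchor (R.partCheck s j)
      = if j.val = C.checkWeight s - 3 then C.check s else 0 := by
  have hj : j.val ≤ C.checkWeight s - 3 := by omega
  rw [partCheck_eq, map_add, map_add, map_sum, retraction_linkOp R s hj, ← add_assoc,
    Finset.sum_congr rfl fun a _ => R.retraction_leg s a, add_comm (∑ _ ∈ _, _), ← prefixOp_succ]
  split_ifs with h
  · rw [h, prefixOp_last, linkOp, dif_neg (by omega), map_zero, add_zero]
  · rw [retraction_linkOp R s (by omega), PauliString.add_self]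

theorem map_gauge : R.gauge.map (retraction R.anchor) = C.stabilizer := by
  rw [gauge, Submodule.map_span]
  refine le_antisymm (Submodule.span_le.2 ?_) (Submodule.span_mono ?_)
  · rintro _ ⟨_, ⟨x | x, rfl⟩ | ⟨r, rfl⟩, rfl⟩
    · rw [check, retraction_linkCheck]
      exact Submodule.zero_mem _
    · rw [check, retraction_partCheck]
      split_ifs
      · exact Submodule.subset_span ⟨_, rfl⟩
      · exact Submodule.zero_mem _
    · rw [retraction_on_inr_X]
      exact Submodule.zero_mem _
  · rintro _ ⟨s, rfl⟩
    refine ⟨_, Or.inl ⟨Sum.inr ⟨s, Fin.last _⟩, rfl⟩, ?_⟩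
    rw [check, retraction_partCheck, Fin.val_last, if_pos rfl]

/-- Multiply the link checks along the chain from `q` to the copy; the intermediate `Z` factors
cancel. -/
theorem copy_add_mem_gauge (q : Q) (P : PauliLetter) (i : ℕ) (hi : i < R.numCopies q P) :
    PauliString.on (R.copy q P ⟨i, hi⟩) Pauli.Z + PauliString.on (R.data q) P.1 ∈ R.gauge := by
  induction i with
  | zero =>
    have h := R.check_mem_gauge (Sum.inl ⟨(q, P), ⟨0, hi⟩⟩)
    rw [check, linkCheck, if_pos rfl, add_comm] at h
    exact h
  | succ i ih =>
    have h := R.check_mem_gauge (Sum.inl ⟨(q, P), ⟨i + 1, hi⟩⟩)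
    rw [check, linkCheck, if_neg (Nat.succ_ne_zero i)] at h
    have h' : PauliString.on (R.copy q P ⟨i, by omega⟩) Pauli.Z
        + PauliString.on (R.copy q P ⟨i + 1, hi⟩) Pauli.Z ∈ R.gauge := h
    have e (u v w : PauliString R.Qubit) : u + v + (u + w) = v + w + (u + u) := by abel
    have h'' := R.gauge.add_mem h' (ih (by omega))
    rwa [e, PauliString.add_self, add_zero] at h''

theorem leg_add_mem_gauge (s : S) (a : Fin (C.checkWeight s)) :
    R.leg s a + (R.factor s a).extend ∈ R.gauge := by
  rw [leg, factor, PauliString.extend_on]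
  split_ifs
  · rw [PauliString.add_self]
    exact R.gauge.zero_mem
  · exact R.copy_add_mem_gauge _ _ _ _

/-- Induction along the parts: in part `j`, trade the incoming ancilla and the legs for their
equivalents on the original qubits; what is left relates the outgoing ancilla to the next prefix. -/
theorem linkOp_add_mem_gauge (s : S) (j : ℕ) (hj : j ≤ C.checkWeight s - 3) :
    R.linkOp s j + (R.prefixOp s j).extend ∈ R.gauge := by
  induction j with
  | zero =>
    rw [prefixOp_zero, map_zero, linkOp, dif_neg (by omega), add_zero]
    exact R.gauge.zero_mem
  | succ j ih =>
    have hlegs : ∑ a : Fin (C.checkWeight s) with min (a.val - 1) (C.checkWeight s - 3) = j,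
        (R.leg s a + (R.factor s a).extend) ∈ R.gauge :=
      Submodule.sum_mem _ fun a _ => R.leg_add_mem_gauge s a
    have h := R.check_mem_gauge (Sum.inr ⟨s, ⟨j, by omega⟩⟩)
    rw [check, partCheck_eq] at h
    have h' := R.gauge.add_mem (R.gauge.add_mem h (ih (by omega))) hlegs
    rw [prefixOp_succ, map_add, map_sum]
    rw [Finset.sum_add_distrib] at h'
    generalize ∑ _ ∈ _, R.leg s _ = u at h'
    generalize ∑ _ ∈ _, (R.factor s _).extend = v at h' ⊢
    generalize R.linkOp s j = x at h'
    generalize R.linkOp s (j + 1) = y at h' ⊢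
    generalize (R.prefixOp s j).extend = z at h' ⊢
    have e : u + (x + y) + (x + z) + (u + v) = y + (z + v) + (u + u) + (x + x) := by abel
    rwa [e, PauliString.add_self, PauliString.add_self, add_zero, add_zero] at h'

theorem gauge_eq_comap : R.gauge = C.stabilizer.comap (retraction R.anchor) := by
  refine eq_comap_retraction R.on_X_mem_gauge (fun r => ?_) R.map_gauge
  rcases r with ⟨⟨q, P⟩, i⟩ | ⟨s, j⟩
  · rw [anchor, PauliString.extend_on]
    exact R.copy_add_mem_gauge q P i i.2
  · have h := R.linkOp_add_mem_gauge s (j.val + 1) j.2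
    rw [linkOp, dif_pos ⟨Nat.succ_pos _, j.2⟩] at h
    rw [anchor_ancilla]
    exact h

theorem weight_anchor_le (hW : 1 ≤ C.maxWeight) (r) : (R.anchor r).weight ≤ C.maxWeight := by
  rcases r with x | ⟨s, j⟩
  · exact (PauliString.weight_on_le _ _).trans hW
  · calc (R.anchor (Sum.inr ⟨s, j⟩)).weight
        ≤ ∑ a : Fin (C.checkWeight s) with min (a.val - 1) (C.checkWeight s - 3) ≤ j.val, 1 :=
          (PauliString.weight_sum_le _ _).trans
            (Finset.sum_le_sum fun a _ => PauliString.weight_on_le _ _)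
      _ ≤ ∑ a : Fin (C.checkWeight s), 1 :=
          Finset.sum_le_sum_of_subset (Finset.filter_subset _ _)
      _ = C.checkWeight s := by simp
      _ ≤ C.maxWeight := Finset.le_sup (f := C.checkWeight) (Finset.mem_univ s)

end Resolution

/-! ### Edge extension as a retraction -/

section EdgeExtension

set_option linter.unusedSectionVars false

variable {A K : Type*} [Fintype A] [DecidableEq A] [Fintype K] [DecidableEq K]
  (check : K → PauliString A) (len : TannerEdge check → ℕ)

/-- The Pauli operator with which the check of an edge acts on the qubit of the edge. -/
def wireAnchor (y : Σ e : TannerEdge check, Fin (len e - 1)) : PauliString A :=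
  PauliString.on y.1.1.2 (check y.1.1.1 y.1.1.2)

/-- All positions of a wire retract to the same operator. The bound on `t` is needed since `wireOp`
is 0 past the end of the wire. -/
theorem retraction_wireOp (e : TannerEdge check) {t : ℕ} (ht : t ≤ len e - 1) :
    retraction (wireAnchor check len) (wireOp check len e t)
      = PauliString.on e.1.2 (check e.1.1 e.1.2) := by
  cases t with
  | zero => rw [wireOp, retraction_on_inl]
  | succ t => rw [wireOp, dif_pos (by omega), retraction_on_inr_Z, wireAnchor]

theorem retraction_extCheck_inl (x : K) :
    retraction (wireAnchor check len) (extCheck check len (Sum.inl x)) = check x := by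
  rw [extCheck, map_sum, Finset.sum_congr rfl fun e _ => retraction_wireOp check len e le_rfl]
  calc ∑ e : TannerEdge check with e.1.1 = x, PauliString.on e.1.2 (check e.1.1 e.1.2)
      = ∑ a with check x a ≠ 0, PauliString.on a (check x a) := by
        refine Finset.sum_bij' (fun e _ => e.1.2)
          (fun a ha => ⟨(x, a), (Finset.mem_filter.1 ha).2⟩) ?_ ?_ ?_ ?_ ?_
        · rintro ⟨⟨y, a⟩, h⟩ he
          obtain rfl := (Finset.mem_filter.1 he).2
          simpa using h
        · simp
        · rintro ⟨⟨y, a⟩, h⟩ he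
          obtain rfl := (Finset.mem_filter.1 he).2
          rfl
        · simp
        · rintro ⟨⟨y, a⟩, h⟩ he
          obtain rfl := (Finset.mem_filter.1 he).2
          rfl
    _ = ∑ a, PauliString.on a (check x a) := by
        refine Finset.sum_filter_of_ne fun a _ h ha => h ?_
        rw [ha]
        exact Pi.single_zero a
    _ = check x := PauliString.sum_on _

theorem retraction_extCheck_inr (y : Σ e : TannerEdge check, Fin (len e - 1)) :
    retraction (wireAnchor check len) (extCheck check len (Sum.inr y)) = 0 := by
  have h := y.2.isLt
  rw [extCheck, map_add, retraction_wireOp check len y.1 (by omega),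
    retraction_wireOp check len y.1 (by omega), PauliString.add_self]

theorem weight_wireAnchor_le (y) : (wireAnchor check len y).weight ≤ 1 :=
  PauliString.weight_on_le _ _

theorem wireOp_add_mem (G : Submodule (ZMod 2) (PauliString (ExtQubit check len)))
    (hG : ∀ y, extCheck check len (Sum.inr y) ∈ G) (e : TannerEdge check) (t : ℕ)
    (ht : t ≤ len e - 1) :
    wireOp check len e t + PauliString.on (Sum.inl e.1.2) (check e.1.1 e.1.2) ∈ G := by
  induction t with
  | zero =>
    rw [wireOp, PauliString.add_self]
    exact G.zero_mem
  | succ t ih =>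
    have h := G.add_mem (hG ⟨e, ⟨t, by omega⟩⟩) (ih (by omega))
    rw [extCheck] at h
    have e (u v w : PauliString (ExtQubit check len)) : u + v + (u + w) = v + w + (u + u) := by abel
    rwa [e, PauliString.add_self, add_zero] at h

end EdgeExtension

/-! ### Gauge group, logical qubits and distance of the wire code -/

namespace Resolution

set_option linter.unusedSectionVars false

variable {Q S : Type*} [Fintype Q] [DecidableEq Q] [Fintype S] [DecidableEq S]
  {C : StabilizerCode Q S} (R : Resolution C) (len : TannerEdge R.check → ℕ)

theorem extCheck_mem_wireGauge (x) : extCheck R.check len x ∈ R.wireGauge len :=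
  Submodule.subset_span (Or.inl ⟨x, rfl⟩)

/-- Retracting the wires deletes only the `X` checks on wire qubits; those on copies and ancillas
remain as generators of `R.gauge`. -/
theorem map_wireGauge :
    (R.wireGauge len).map (retraction (wireAnchor R.check len)) = R.gauge := by
  rw [wireGauge, Submodule.map_span]
  refine le_antisymm (Submodule.span_le.2 ?_) (Submodule.span_le.2 ?_)
  · rintro _ ⟨_, ⟨x | x, rfl⟩ | ⟨(q | r) | y, hx, rfl⟩, rfl⟩
    · rw [retraction_extCheck_inl]
      exact R.check_mem_gauge x
    · rw [retraction_extCheck_inr]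
      exact Submodule.zero_mem _
    · exact absurd rfl (hx q)
    · rw [retraction_on_inl]
      exact R.on_X_mem_gauge r
    · rw [retraction_on_inr_X]
      exact Submodule.zero_mem _
  · rintro _ (⟨x, rfl⟩ | ⟨r, rfl⟩)
    · exact Submodule.subset_span
        ⟨_, Or.inl ⟨Sum.inl x, rfl⟩, retraction_extCheck_inl R.check len x⟩
    · exact Submodule.subset_span
        ⟨_, Or.inr ⟨Sum.inl (Sum.inr r), by simp, rfl⟩, retraction_on_inl _ _ _⟩

theorem wireGauge_eq_comap :
    R.wireGauge len = R.gauge.comap (retraction (wireAnchor R.check len)) := by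
  refine eq_comap_retraction (fun y => ?_) (fun y => ?_) (R.map_wireGauge len)
  · exact Submodule.subset_span (Or.inr ⟨Sum.inr y, by simp, rfl⟩)
  · have h := wireOp_add_mem R.check len (R.wireGauge len)
      (fun y => R.extCheck_mem_wireGauge len _) y.1 (y.2.val + 1) y.2.isLt
    rw [wireOp, dif_pos y.2.isLt] at h
    rw [wireAnchor, PauliString.extend_on]
    exact h

theorem finrank_logical_wireGauge :
    Module.finrank (ZMod 2) (↥(commutant (R.wireGauge len)) ⧸
        (R.wireGauge len).submoduleOf (commutant (R.wireGauge len))) =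
      Module.finrank (ZMod 2)
        (↥(commutant C.stabilizer) ⧸ C.stabilizer.submoduleOf (commutant C.stabilizer)) := by
  rw [wireGauge_eq_comap, finrank_logical_comap_retraction, gauge_eq_comap,
    finrank_logical_comap_retraction]

theorem codeDistance_le_wireGauge (hW : 1 ≤ C.maxWeight) :
    codeDistance C.stabilizer ≤ C.maxWeight * codeDistance (R.wireGauge len) := by
  refine codeDistance_le_mul hW
    (fun L => retraction R.anchor (retraction (wireAnchor R.check len) L)) (fun L hL => ?_)
    fun L => ?_
  · rw [wireGauge_eq_comap] at hL
    have h := retraction_mem_dressedLogicals hL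
    rw [gauge_eq_comap] at h
    exact retraction_mem_dressedLogicals h
  · refine (weight_retraction_le hW (R.weight_anchor_le hW) _).trans ?_
    have h := weight_retraction_le le_rfl (weight_wireAnchor_le R.check len) L
    rw [one_mul] at h
    exact Nat.mul_le_mul_left _ h

end Resolution

/-! ### The number of qubits -/

namespace Resolution

set_option linter.unusedSectionVars false

variable {Q S : Type*} [Fintype Q] [DecidableEq Q] [Fintype S] [DecidableEq S]
  {C : StabilizerCode Q S} (R : Resolution C)

theorem sum_checkWeight_le : ∑ s, C.checkWeight s ≤ C.maxDegree * Fintype.card Q := by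
  calc ∑ s, C.checkWeight s = ∑ q, C.degree q := by
        simp only [StabilizerCode.checkWeight, PauliString.weight, StabilizerCode.degree,
          Finset.card_filter]
        exact Finset.sum_comm
    _ ≤ ∑ q : Q, C.maxDegree :=
        Finset.sum_le_sum fun q _ => Finset.le_sup (f := C.degree) (Finset.mem_univ q)
    _ = C.maxDegree * Fintype.card Q := by simp [mul_comm]

theorem numCopies_le (q : Q) (P : PauliLetter) : R.numCopies q P ≤ C.maxDegree := by
  have h : C.letterDegree q P ≤ C.degree q := by
    refine Finset.card_le_card fun s hs => ?_
    simp only [Finset.mem_filter, Finset.mem_univ, true_and] at hs ⊢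
    rw [hs]
    exact P.2
  have h' : C.degree q ≤ C.maxDegree := Finset.le_sup (f := C.degree) (Finset.mem_univ q)
  rw [numCopies]
  split_ifs <;> omega

theorem sum_numCopies_le :
    ∑ x : Q × PauliLetter, R.numCopies x.1 x.2 ≤ 3 * (C.maxDegree * Fintype.card Q) := by
  have h3 : Fintype.card PauliLetter = 3 := by decide
  calc ∑ x : Q × PauliLetter, R.numCopies x.1 x.2 ≤ ∑ x : Q × PauliLetter, C.maxDegree :=
        Finset.sum_le_sum fun x _ => R.numCopies_le x.1 x.2
    _ = 3 * (C.maxDegree * Fintype.card Q) := by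
        rw [Finset.sum_const, Finset.card_univ, Fintype.card_prod, h3, smul_eq_mul]
        ring

theorem card_qubit_le :
    Fintype.card R.Qubit ≤ Fintype.card Q + 4 * (C.maxDegree * Fintype.card Q) := by
  have h1 := R.sum_numCopies_le
  have h2 : ∑ s, (C.checkWeight s - 3) ≤ C.maxDegree * Fintype.card Q :=
    (Finset.sum_le_sum fun s _ => Nat.sub_le _ 3).trans sum_checkWeight_le
  simp only [Fintype.card_sum, Fintype.card_sigma, Fintype.card_fin]
  omega

theorem weight_linkCheck_le (q : Q) (P : PauliLetter) (i : Fin (R.numCopies q P)) :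
    (R.linkCheck q P i).weight ≤ 2 := by
  refine (PauliString.weight_add_le _ _).trans (add_le_add (b := 1) (d := 1) ?_ ?_)
  · split_ifs <;> exact PauliString.weight_on_le _ _
  · exact PauliString.weight_on_le _ _

theorem weight_leg_le (s : S) (a : Fin (C.checkWeight s)) : (R.leg s a).weight ≤ 1 := by
  rw [leg]
  split_ifs <;> exact PauliString.weight_on_le _ _

theorem weight_linkOp_le (s : S) (j : ℕ) :
    (R.linkOp s j).weight ≤ if 0 < j ∧ j - 1 < C.checkWeight s - 3 then 1 else 0 := by
  rw [linkOp]
  split_ifs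
  · exact PauliString.weight_on_le _ _
  · exact PauliString.weight_zero.le

/-- Each leg lies in exactly one part, and the incoming and the outgoing ancillas each contribute at
most `w` in total. -/
theorem sum_weight_partCheck_le (s : S) :
    ∑ j, (R.partCheck s j).weight ≤ 3 * C.checkWeight s := by
  have hlegs : ∑ j : Fin (C.checkWeight s - 3 + 1),
      (∑ a : Fin (C.checkWeight s) with min (a.val - 1) (C.checkWeight s - 3) = j.val,
        R.leg s a).weight ≤ C.checkWeight s := by
    calc _ ≤ ∑ j : Fin (C.checkWeight s - 3 + 1),
          ∑ a : Fin (C.checkWeight s) with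
            (⟨min (a.val - 1) (C.checkWeight s - 3), by omega⟩ : Fin (C.checkWeight s - 3 + 1)) = j,
            1 := by
          refine Finset.sum_le_sum fun j _ => (PauliString.weight_sum_le _ _).trans ?_
          simp only [Fin.ext_iff]
          exact Finset.sum_le_sum fun a _ => R.weight_leg_le s a
      _ = C.checkWeight s := by
          rw [Finset.sum_fiberwise]
          simp
  have hlink : ∀ d, ∑ j : Fin (C.checkWeight s - 3 + 1), (R.linkOp s (j + d)).weight
      ≤ C.checkWeight s := fun d => by
    -- Without ancillas the sum vanishes; otherwise there are `w - 2` parts, each with at most one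
    -- such ancilla.
    rcases Nat.eq_zero_or_pos (C.checkWeight s - 3) with h | h
    · refine (Finset.sum_le_sum fun j _ => R.weight_linkOp_le s _).trans ?_
      simp [h]
    · calc _ ≤ ∑ j : Fin (C.checkWeight s - 3 + 1), 1 := by
            refine Finset.sum_le_sum fun j _ => (R.weight_linkOp_le s _).trans ?_
            split_ifs <;> omega
        _ ≤ C.checkWeight s := by
            simp only [Finset.sum_const, Finset.card_univ, Fintype.card_fin, smul_eq_mul]
            omega
  calc ∑ j, (R.partCheck s j).weight
      ≤ ∑ j : Fin (C.checkWeight s - 3 + 1),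
        ((∑ a : Fin (C.checkWeight s) with min (a.val - 1) (C.checkWeight s - 3) = j.val,
          R.leg s a).weight + ((R.linkOp s (j + 0)).weight + (R.linkOp s (j + 1)).weight)) := by
        refine Finset.sum_le_sum fun j _ => ?_
        rw [partCheck_eq, add_zero]
        exact (PauliString.weight_add_le _ _).trans
          (Nat.add_le_add_left (PauliString.weight_add_le _ _) _)
    _ ≤ 3 * C.checkWeight s := by
        rw [Finset.sum_add_distrib, Finset.sum_add_distrib]
        have h0 := hlink 0
        have h1 := hlink 1
        omega

theorem card_tannerEdge {A K : Type*} [Fintype A] [DecidableEq A] [Fintype K]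
    (check : K → PauliString A) :
    Fintype.card (TannerEdge check) = ∑ x, (check x).weight := by
  rw [Fintype.card_subtype]
  simp only [PauliString.weight, Finset.card_filter]
  rw [Fintype.sum_prod_type]

/-- Link checks give 2 · 3 and parts of checks give 3, in units of `δ n`. -/
theorem card_tannerEdge_check_le :
    Fintype.card (TannerEdge R.check) ≤ 9 * (C.maxDegree * Fintype.card Q) := by
  rw [card_tannerEdge, Fintype.sum_sum_type]
  have h1 : ∑ x : Σ x : Q × PauliLetter, Fin (R.numCopies x.1 x.2), (R.check (Sum.inl x)).weight
      ≤ 2 * ∑ x : Q × PauliLetter, R.numCopies x.1 x.2 := by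
    calc _ ≤ ∑ x : Σ x : Q × PauliLetter, Fin (R.numCopies x.1 x.2), 2 :=
          Finset.sum_le_sum fun x _ => R.weight_linkCheck_le _ _ _
      _ = _ := by simp [mul_comm]
  have h2 : ∑ x : Σ s, Fin (C.checkWeight s - 3 + 1), (R.check (Sum.inr x)).weight
      ≤ 3 * ∑ s, C.checkWeight s := by
    rw [Finset.mul_sum, Fintype.sum_sigma]
    exact Finset.sum_le_sum fun s _ => R.sum_weight_partCheck_le s
  have h3 := R.sum_numCopies_le
  have h4 := sum_checkWeight_le (C := C)
  omega

/-- Without edges every resolved check would be trivial, but the last part of `s` retracts to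
`C.check s`. An edge is what makes the maximal length positive. -/
theorem nonempty_tannerEdge (h : ∃ s, C.check s ≠ 0) : Nonempty (TannerEdge R.check) := by
  by_contra hne
  obtain ⟨s, hs⟩ := h
  have h0 : R.check (Sum.inr ⟨s, Fin.last _⟩) = 0 := by
    funext a
    by_contra ha
    exact hne ⟨⟨(_, a), ha⟩⟩
  have h1 := R.retraction_partCheck s (Fin.last _)
  rw [check] at h0
  rw [h0, map_zero, Fin.val_last, if_pos rfl] at h1
  exact hs h1.symm

/-- 14 = 1 + 4 + 9: original qubits, copies and ancillas, wire qubits; `M ≥ 1` and `δ ≥ 1` absorb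
the smaller terms. -/
theorem card_wireQubit_le (len : TannerEdge R.check → ℕ) {M : ℕ} (hM : 1 ≤ M)
    (hδ : 1 ≤ C.maxDegree) (hlen : ∀ e, len e ≤ M) :
    Fintype.card (R.WireQubit len) ≤ 14 * (M * C.maxDegree * Fintype.card Q) := by
  have h1 : ∑ e, (len e - 1) ≤ M * Fintype.card (TannerEdge R.check) := by
    calc ∑ e, (len e - 1) ≤ ∑ e : TannerEdge R.check, M :=
          Finset.sum_le_sum fun e _ => (Nat.sub_le _ _).trans (hlen e)
      _ = _ := by rw [Finset.sum_const, Finset.card_univ, smul_eq_mul, mul_comm]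
  have h2 := Nat.mul_le_mul_left M R.card_tannerEdge_check_le
  have h3 := R.card_qubit_le
  have h4 : Fintype.card Q ≤ C.maxDegree * Fintype.card Q := Nat.le_mul_of_pos_left _ hδ
  have h5 : C.maxDegree * Fintype.card Q ≤ M * (C.maxDegree * Fintype.card Q) :=
    Nat.le_mul_of_pos_left _ hM
  have h7 : Fintype.card (R.WireQubit len) = Fintype.card R.Qubit + ∑ e, (len e - 1) := by
    rw [Fintype.card_sum, Fintype.card_sigma]
    exact congrArg _ (Finset.sum_congr rfl fun e _ => Fintype.card_fin _)
  rw [mul_assoc, h7]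
  have h6 : M * (9 * (C.maxDegree * Fintype.card Q)) = 9 * (M * (C.maxDegree * Fintype.card Q)) := by
    ring
  omega

end Resolution

theorem StabilizerCode.one_le_maxWeight {Q S : Type*} [Fintype Q] [Fintype S]
    {C : StabilizerCode Q S} (h : ∃ s, C.check s ≠ 0) : 1 ≤ C.maxWeight := by
  obtain ⟨s, hs⟩ := h
  obtain ⟨q, hq⟩ := Function.ne_iff.1 hs
  refine le_trans (Finset.card_pos.2 ⟨q, ?_⟩) (Finset.le_sup (f := C.checkWeight) (Finset.mem_univ s))
  simpa using hq

theorem StabilizerCode.one_le_maxDegree {Q S : Type*} [Fintype Q] [Fintype S]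
    {C : StabilizerCode Q S} (h : ∃ s, C.check s ≠ 0) : 1 ≤ C.maxDegree := by
  obtain ⟨s, hs⟩ := h
  obtain ⟨q, hq⟩ := Function.ne_iff.1 hs
  refine le_trans (Finset.card_pos.2 ⟨s, ?_⟩) (Finset.le_sup (f := C.degree) (Finset.mem_univ q))
  simpa using hq

/-! ### Locality and density -/

namespace TannerEmbedding

section Support

set_option linter.unusedSectionVars false

variable {A K : Type*} [Fintype A] [DecidableEq A] [Fintype K] [DecidableEq K]
  {check : K → PauliString A} {len : TannerEdge check → ℕ}

theorem eq_of_wireOp_ne_zero {e : TannerEdge check} {t : ℕ} {x : ExtQubit check len}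
    (h : wireOp check len e t x ≠ 0) :
    (t = 0 ∧ x = Sum.inl e.1.2) ∨ ∃ i : Fin (len e - 1), i.val + 1 = t ∧ x = Sum.inr ⟨e, i⟩ := by
  have aux : ∀ {y : ExtQubit check len} {P}, PauliString.on y P x ≠ 0 → x = y := fun h => by
    by_contra hne
    exact h (Pi.single_eq_of_ne hne _)
  cases t with
  | zero => exact Or.inl ⟨rfl, aux h⟩
  | succ t =>
    rw [wireOp] at h
    split_ifs at h with ht
    · exact Or.inr ⟨⟨t, ht⟩, rfl, aux h⟩
    · exact absurd rfl h

end Support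

variable {A K V : Type*} {check : K → PauliString A} {G : SimpleGraph V} {c : ℕ}
  (φ : TannerEmbedding check G c)

/-- With `p` the path of `e`, position `t ≥ 1` of the wire sits on the edge from `p_t` to `p_{t+1}`,
and position 0 sits at `p_0`, a neighbour of `p_1`. -/
theorem near_getVert {e : TannerEdge check} {t : ℕ} (ht : t < φ.length e)
    [Fintype A] [DecidableEq A] [Fintype K] [DecidableEq K]
    {x : ExtQubit check φ.length} (hx : wireOp check φ.length e t x ≠ 0) :
    Site.Near ((φ.path e).getVert (t + 1)) (φ.site x) := by
  rcases eq_of_wireOp_ne_zero hx with ⟨rfl, rfl⟩ | ⟨i, rfl, rfl⟩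
  · have h := (φ.path e).adj_getVert_succ (i := 0) ht
    rw [SimpleGraph.Walk.getVert_zero] at h
    exact Or.inr h.symm
  · exact Sym2.mem_mk_right _ _

theorem near_getVert_self {e : TannerEdge check} {t : ℕ} (ht : t + 1 < φ.length e)
    [Fintype A] [DecidableEq A] [Fintype K] [DecidableEq K]
    {x : ExtQubit check φ.length} (hx : wireOp check φ.length e (t + 1) x ≠ 0) :
    Site.Near ((φ.path e).getVert (t + 1)) (φ.site x) := by
  rcases eq_of_wireOp_ne_zero hx with ⟨h, -⟩ | ⟨i, h, rfl⟩
  · exact absurd h (Nat.succ_ne_zero t)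
  · obtain rfl : i.val = t := Nat.succ.inj h
    exact Sym2.mem_mk_left _ _

theorem site_near (x : ExtQubit check φ.length) : ∃ v, Site.Near v (φ.site x) := by
  rcases x with a | y
  · exact ⟨_, Or.inl rfl⟩
  · exact ⟨_, Sym2.mem_mk_left _ _⟩

/-- Each wire of a check `k` ends next to the image of `k`. The operators at positions `t` and `t +
1` of a wire meet at vertex `t + 1` of its path. -/
theorem isLocalOn_extCheck [Fintype A] [DecidableEq A] [Fintype K] [DecidableEq K] :
    IsLocalOn G φ.site (Set.range (extCheck check φ.length)) := by
  rintro _ ⟨k | ⟨e, t⟩, rfl⟩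
  · refine ⟨φ.node (Sum.inr k), fun x hx => ?_⟩
    rw [extCheck, Finset.sum_apply] at hx
    obtain ⟨e, he, hne⟩ := Finset.exists_ne_zero_of_sum_ne_zero hx
    obtain rfl := (Finset.mem_filter.1 he).2
    have hpos := φ.length_pos e
    have h := φ.near_getVert (show φ.length e - 1 < φ.length e by
      exact Nat.sub_lt hpos one_pos) hne
    rwa [Nat.sub_add_cancel (show 1 ≤ φ.length e from hpos), length,
      SimpleGraph.Walk.getVert_length] at h
  · have ht := t.2
    refine ⟨(φ.path e).getVert (t.val + 1), fun x hx => ?_⟩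
    by_cases h : wireOp check φ.length e t x = 0
    · refine φ.near_getVert_self (by omega) fun h' => hx ?_
      rw [extCheck, Pi.add_apply, h, h', add_zero]
    · exact φ.near_getVert (by omega) h

theorem hasDensityAtMost_site [Finite A] [Finite K] : HasDensityAtMost G φ.site c := by
  rintro (v | f)
  -- The second branch of the map is a filler, as no wire qubit sits at a vertex.
  · refine le_trans (Set.ncard_le_ncard_of_injOn (Sum.elim Sum.inl fun y => Sum.inl y.1.1.2)
      ?_ ?_ (Set.toFinite _)) (φ.vertex_load v)
    · rintro (a | y) h
      · exact Sum.inl.inj h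
      · cases h
    · rintro (a | y) h (a' | y') h' e
      · rw [Sum.inl.inj e]
      · cases h'
      · cases h
      · cases h
  · let wire : Set (Σ e : TannerEdge check, Fin (φ.length e - 1)) :=
      {y | s((φ.path y.1).getVert (y.2.val + 1), (φ.path y.1).getVert (y.2.val + 1 + 1)) = f.1}
    have hsub : {x | φ.site x = Sum.inr f} ⊆ Sum.inr '' wire := by
      rintro (a | y) h
      · cases h
      · exact ⟨y, congrArg Subtype.val (Sum.inr.inj h), rfl⟩
    refine (Set.ncard_le_ncard hsub (Set.toFinite _)).trans ((Set.ncard_image_le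
      -- Sending a wire qubit on `f` to its Tanner edge is injective because a path crosses `f` at
      -- most once.
      (Set.toFinite _)).trans (le_trans (Set.ncard_le_ncard_of_injOn (fun y => y.1) ?_ ?_
      (Set.toFinite _)) (φ.edge_load f.1 f.2)))
    · rintro ⟨e, t⟩ (h : _ = f.1)
      have ht : t.val + 1 < (φ.path e).length := by
        have h1 := t.2
        have h2 : φ.length e = (φ.path e).length := rfl
        omega
      rw [Set.mem_ofPred_eq, ← h]
      exact (φ.path e).mk_mem_edges_iff_exists.2 ⟨_, ht, rfl⟩
    · rintro ⟨e, t⟩ (h : _ = f.1) ⟨e', t'⟩ (h' : _ = f.1) (rfl : e = e')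
      have h1 : t.val < (φ.path e).length - 1 := t.2
      have h2 : t'.val < (φ.path e).length - 1 := t'.2
      have inj : ∀ i j, i ≤ (φ.path e).length → j ≤ (φ.path e).length →
          (φ.path e).getVert i = (φ.path e).getVert j → i = j :=
        fun i j hi hj => (φ.isPath e).getVert_injOn hi hj
      have htt : t.val = t'.val := by
        rcases Sym2.eq_iff.1 (h.trans h'.symm) with ⟨h4, -⟩ | ⟨h4, h5⟩
        · have := inj (t.val + 1) (t'.val + 1) (by omega) (by omega) h4
          omega
        -- Crossing `f` in opposite directions would give `t = t' + 1` and `t + 1 = t'`.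
        · have := inj (t.val + 1) (t'.val + 1 + 1) (by omega) (by omega) h4
          have := inj (t.val + 1 + 1) (t'.val + 1) (by omega) (by omega) h5
          omega
      rw [Fin.ext htt]

end TannerEmbedding

/-! ### The embedding theorem -/

theorem mainTheorem2 :
    ∃ C₁ C₂ : ℕ, ∀ (Q S V : Type*) [Fintype Q] [DecidableEq Q] [Fintype S] [DecidableEq S]
      (C : StabilizerCode Q S) (n k : ℕ) (d : ℕ∞),
      HasParameters C.stabilizer n k d → (∃ s, C.check s ≠ 0) →
      ∀ (R : Resolution C) (G : SimpleGraph V) (c : ℕ) (φ : TannerEmbedding R.check G c),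
        (∃ (n' : ℕ) (d' : ℕ∞),
          HasParameters (R.wireGauge φ.length) n' k d' ∧
          n' ≤ C₁ * (φ.maxLength * C.maxDegree * n) ∧
          d ≤ C₂ * (C.maxWeight * d')) ∧
        IsLocalOn G φ.site (R.wireChecks φ.length) ∧
        HasDensityAtMost G φ.site c := by
  refine ⟨14, 1, ?_⟩
  intro Q S V _ _ _ _ C n k d hC hne R G c φ
  have hlen : ∀ e, φ.length e ≤ φ.maxLength := fun e => Finset.le_sup (Finset.mem_univ e)
  refine ⟨⟨_, _, ⟨rfl, ?_, rfl⟩, ?_, ?_⟩, ?_, φ.hasDensityAtMost_site⟩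
  · rw [R.finrank_logical_wireGauge, hC.logical_qubits]
  · obtain ⟨e⟩ := R.nonempty_tannerEdge hne
    rw [← hC.card_qubits]
    exact R.card_wireQubit_le φ.length ((φ.length_pos e).trans_le (hlen e))
      (StabilizerCode.one_le_maxDegree hne) hlen
  · rw [Nat.cast_one, one_mul, ← hC.distance]
    exact R.codeDistance_le_wireGauge φ.length (StabilizerCode.one_le_maxWeight hne)
  · rintro p (hp | ⟨x, -, rfl⟩)
    · exact φ.isLocalOn_extCheck p hp
    · obtain ⟨v, hv⟩ := φ.site_near x
      refine ⟨v, fun y hy => ?_⟩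
      obtain rfl : y = x := by
        by_contra h
        exact hy (Pi.single_eq_of_ne h _)
      exact hv
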